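/- For binary strings $t,s_1,\dots,s_k$ let $K(t\mid s_1,\dots,s_k)$ denote conditional (plain) Kolmogorov complexity: the minimal length of a binary program that transforms the tuple $(s_1,\dots,s_k)$ into $t$, with respect to a fixed optimal partial computable decompressor $U$ (one whose complexity function is, up to an additive constant, at most that of any other partial computable decompressor). Then there are constants $d$ and $C$, depending only on $U$, such that for all natural numbers $n,m,c$ with $3c+d<n$ and $2m+c+d<3n$ there exist binary strings $x,y,z,t$ of length $n$ such that $K(t\mid x,y,z)\le C\log_2 n$, but there are no binary strings $a,b$ of length $m$ such that $$K(a\mid x,y)<c,\qquad K(b\mid y,z)<c,\qquad K(t\mid a,b)<c.$$ -/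

import Mathlib

namespace Kolmogorov

/-- A binary string. -/
abbrev Str : Type := List Bool

/-- A conditional decompressor (description mode): a partial map taking a program and a condition,
which is a finite tuple of strings, to a string. -/
abbrev Decompressor : Type := Str → List Str →. Str

/-- The conditional complexity `K_D(t | s)` with respect to the decompressor `D`: the least length
of a program `p` such that `D` halts on `p` with condition `s` and outputs `t`
(`⊤` if there is none). -/
noncomputable def complexity (D : Decompressor) (t : Str) (s : List Str) : ℕ∞ :=
  ⨅ p : {p : Str // t ∈ D p s}, ((p : Str).length : ℕ∞)

/-- An optimal decompressor: it is partial computable, and up to an additive constant its complexity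
is at most that of any other partial computable decompressor. -/
structure IsOptimal (U : Decompressor) : Prop where
  partrec : Partrec₂ U
  le_add : ∀ V : Decompressor, Partrec₂ V →
    ∃ k : ℕ, ∀ (t : Str) (s : List Str), complexity U t s ≤ complexity V t s + k

/-- Optimal decompressors exist: the program `1 ^ k 0 q` runs the `k`-th partial recursive function
on the program `q`. -/
theorem exists_isOptimal : ∃ U : Decompressor, IsOptimal U := by
  let idx : Str → ℕ := fun p => p.findIdx (fun b => !b)
  let rest : Str → Str := fun p => List.tail^[idx p + 1] p
  have hidx : Primrec idx := Primrec.list_findIdx Primrec.id (Primrec.not.comp Primrec.snd).to₂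
  have hrest : Primrec rest :=
    Primrec.nat_iterate (Primrec.succ.comp hidx) Primrec.id
      (Primrec.list_tail.comp Primrec.snd).to₂
  have hcode : Primrec fun n : ℕ => Denumerable.ofNat Nat.Partrec.Code n := Primrec.ofNat _
  let U : Decompressor := fun p s =>
    ((Denumerable.ofNat Nat.Partrec.Code (idx p)).eval (Encodable.encode (rest p, s))).bind
      fun n => (Encodable.decode (α := Str) n : Part Str)
  have hU : Partrec₂ U := by
    refine Partrec.bind (Nat.Partrec.Code.eval_part.comp
      (hcode.comp (hidx.comp Primrec.fst)).to_comp
      (Primrec.encode.comp ((hrest.comp Primrec.fst).pair Primrec.snd)).to_comp) ?_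
    exact (Computable.ofOption (Computable.decode.comp Computable.snd)).to₂
  refine ⟨U, hU, fun V hV => ?_⟩
  obtain ⟨c, hc⟩ := Nat.Partrec.Code.exists_code.1 hV
  refine ⟨Encodable.encode c + 1, fun t s => ?_⟩
  unfold complexity
  rw [ENat.iInf_add]
  refine le_iInf fun ⟨q, hq⟩ => ?_
  have hi : idx (List.replicate (Encodable.encode c) true ++ false :: q) = Encodable.encode c := by
    simp only [idx]
    generalize Encodable.encode c = k
    induction k with
    | zero => simp [List.findIdx_cons]
    | succ k ih => simp [List.replicate_succ, List.findIdx_cons, ih]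
  have hr : rest (List.replicate (Encodable.encode c) true ++ false :: q) = q := by
    simp only [rest, hi]
    generalize Encodable.encode c = k
    induction k with
    | zero => simp
    | succ k ih => simpa [List.replicate_succ, Function.iterate_succ_apply] using ih
  have hmem : t ∈ U (List.replicate (Encodable.encode c) true ++ false :: q) s := by
    simp only [U, hi, hr, Denumerable.ofNat_encode, hc]
    simpa using hq
  refine (iInf_le _ ⟨_, hmem⟩).trans ?_
  simp only [List.length_append, List.length_replicate, List.length_cons]
  norm_cast
  omega

end Kolmogorov

/-!
The proof is a counting argument made effective by exhaustive search.

An adversary who transmits `a` and `b` with programs shorter than `c` is described by three finite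
tables: one gives `a` from a program and `x, y`, one gives `b` from a program and `y, z`, and one
gives `t` from a program and `a, b`. Fix a function `F` that assigns to every triple `x, y, z` of
strings of length `n` a list of `n` candidates for `t`. If the adversary succeeded on all triples
and all candidates, then each of the `n * 2 ^ (3 * n)` values of `F` would be one of at most
`2 ^ (3 * c)` values determined by the tables and the place. So a triple of tables defeats at most
`2 ^ (3 * c * n * 2 ^ (3 * n))` of the `2 ^ (n * n * 2 ^ (3 * n))` functions `F`, while the number
of triples of tables is `2 ^ (2 * m * 2 ^ (2 * n + c) + n * 2 ^ (2 * m + c))`. Under the hypotheses,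
with `d = 3`, the product is too small to exhaust all `F`, so some `F` escapes every adversary
(`exists_isRich`). The lists have length `n`, rather than `1`, because `n - 3 * c` is only bounded
below by a constant: a single value per triple would not outweigh the factor `n` in the size of the
third table.

Escaping every adversary is a primitive recursive property of a code of `F`
(`primrecPred_isRich`), so the least such code is computable from `n, m, c`. As `n` is the length
of the condition strings, a candidate in the list of `x, y, z` is described by `m`, `c` and its
position in the list, which takes `O(log n)` bits (`exists_isRich_complexity_le`).
The tables computed by the given decompressor `U` need not be computable as total functions, but
they are among the finitely many tables considered (`exists_code`), and a place where `F` escapes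
them yields `x, y, z, t`.

All finite objects (strings, tables, functions `F`) are coded by natural numbers, a table being the
number whose digits are its entries.
-/

namespace Kolmogorov

/-! ### Strings and numbers -/

/-- The number with binary digits `s`, least significant digit first. -/
def val (s : Str) : ℕ := s.foldr (fun b v => b.toNat + 2 * v) 0

/-- The string of the `n` lowest binary digits of `v`, least significant digit first. -/
def bits (n v : ℕ) : Str := (List.range n).map fun i => decide (v / 2 ^ i % 2 = 1)

/-- The `j`-th digit of `a` in base `b`. A number `a < b ^ D` codes the table `digit b a` of `D`
entries less than `b`. -/
def digit (b a j : ℕ) : ℕ := a / b ^ j % b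

@[simp] theorem length_bits (n v : ℕ) : (bits n v).length = n := by simp [bits]

theorem val_cons (b : Bool) (s : Str) : val (b :: s) = b.toNat + 2 * val s := rfl

theorem bits_succ (n v : ℕ) : bits (n + 1) v = decide (v % 2 = 1) :: bits n (v / 2) := by
  simp [bits, List.range_succ_eq_map, Function.comp_def, pow_succ', Nat.div_div_eq_div_mul]

theorem val_bits (n v : ℕ) : val (bits n v) = v % 2 ^ n := by
  induction n generalizing v with
  | zero => simp [bits, val, Nat.mod_one]
  | succ n ih =>
    rw [bits_succ, val_cons, ih, pow_succ', Nat.mod_mul]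
    rcases Nat.mod_two_eq_zero_or_one v with h | h <;> simp [h]

theorem bits_val (s : Str) : bits s.length (val s) = s := by
  induction s with
  | nil => rfl
  | cons b s ih =>
    have h : (b.toNat + 2 * val s) / 2 = val s := by
      cases b
      · simp
      · simp; omega
    rw [List.length_cons, bits_succ, val_cons, h, ih]
    cases b <;> simp [Nat.add_mod]

theorem val_lt (s : Str) : val s < 2 ^ s.length := by
  rw [← bits_val s, val_bits, length_bits]
  exact Nat.mod_lt _ (by positivity)

theorem val_append (s t : Str) : val (s ++ t) = val s + 2 ^ s.length * val t := by
  induction s with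
  | nil => simp [val]
  | cons b s ih =>
    rw [List.cons_append, val_cons, val_cons, ih, List.length_cons, pow_succ']
    ring

theorem val_injOn {s t : Str} (hl : s.length = t.length) (h : val s = val t) : s = t := by
  rw [← bits_val s, ← bits_val t, hl, h]

/-- An injective numbering of all strings, appending a final `1` so that the length is not lost.
It numbers the strings of length less than `c` by numbers less than `2 ^ c`. -/
def progIndex (p : Str) : ℕ := val (p ++ [true])

theorem progIndex_eq (p : Str) : progIndex p = val p + 2 ^ p.length := by
  rw [progIndex, val_append]
  simp [val]

theorem progIndex_lt {p : Str} {c : ℕ} (h : p.length < c) : progIndex p < 2 ^ c := by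
  refine (val_lt _).trans_le (Nat.pow_le_pow_right two_pos ?_)
  simpa using h

theorem progIndex_injective : Function.Injective progIndex := by
  intro p q h
  have key : ∀ {p q : Str}, p.length < q.length → progIndex p ≠ progIndex q := by
    intro p q hl h
    have h1 := progIndex_lt hl
    rw [h, progIndex_eq] at h1
    omega
  rcases lt_trichotomy p.length q.length with hl | hl | hl
  · exact absurd h (key hl)
  · exact List.append_cancel_right (val_injOn (by simp [hl]) h)
  · exact absurd h.symm (key hl)

/-! ### Tables coded by numbers -/

theorem exists_digit_eq {b : ℕ} (D : ℕ) (g : ℕ → ℕ) (hg : ∀ j, g j < b) :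
    ∃ a < b ^ D, ∀ j < D, digit b a j = g j := by
  let φ : Fin D → Fin b := fun j => ⟨g j, hg j⟩
  refine ⟨finFunctionFinEquiv φ, (finFunctionFinEquiv φ).2, fun j hj => ?_⟩
  have := congrFun (finFunctionFinEquiv.symm_apply_apply φ) ⟨j, hj⟩
  exact congrArg Fin.val this

theorem eq_of_digit_eq {b D f g : ℕ} (hf : f < b ^ D) (hg : g < b ^ D)
    (h : ∀ j < D, digit b f j = digit b g j) : f = g := by
  have : (⟨f, hf⟩ : Fin (b ^ D)) = ⟨g, hg⟩ := by
    apply finFunctionFinEquiv.symm.injective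
    ext j
    simpa [digit] using h j j.2
  simpa using this

/-- A table whose `D` entries are each restricted to `S` given values is determined by `D` choices
among `S`. -/
theorem card_covered_le (b D S : ℕ) (g : ℕ → ℕ → ℕ) :
    (Set.ncard {f | f < b ^ D ∧ ∀ j < D, ∃ s < S, digit b f j = g s j}) ≤ S ^ D := by
  set X := {f | f < b ^ D ∧ ∀ j < D, ∃ s < S, digit b f j = g s j}
  have hX : ∀ f : X, ∀ j : Fin D, ∃ s : Fin S, digit b f j = g s j := fun f j => by
    obtain ⟨s, hs, h⟩ := f.2.2 j j.2
    exact ⟨⟨s, hs⟩, h⟩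
  choose σ hσ using hX
  have hinj : Function.Injective σ := fun f f' h => by
    refine Subtype.ext (eq_of_digit_eq f.2.1 f'.2.1 fun j hj => ?_)
    have h1 := hσ f ⟨j, hj⟩
    have h2 := hσ f' ⟨j, hj⟩
    rw [h] at h1
    exact h1.trans h2.symm
  rw [← Nat.card_coe_set_eq]
  refine (Nat.card_le_card_of_injective σ hinj).trans ?_
  simp

/-- The place, in a table coded by a number, of the entry for the program number `p` and for two
strings of length `n` with values `x` and `y`. -/
def pairIndex (n x y p : ℕ) : ℕ := x + 2 ^ n * (y + 2 ^ n * p)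

theorem pairIndex_lt {n c x y p : ℕ} (hx : x < 2 ^ n) (hy : y < 2 ^ n) (hp : p < 2 ^ c) :
    pairIndex n x y p < 2 ^ (2 * n + c) := by
  have h1 : y + 2 ^ n * p < 2 ^ (n + c) := by
    rw [pow_add]; nlinarith
  rw [two_mul, add_assoc, pow_add, pairIndex]; nlinarith

theorem pairIndex_inj {n x y p x' y' p' : ℕ} (hx : x < 2 ^ n) (hy : y < 2 ^ n) (hx' : x' < 2 ^ n)
    (hy' : y' < 2 ^ n) (h : pairIndex n x y p = pairIndex n x' y' p') :
    x = x' ∧ y = y' ∧ p = p' := by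
  have key : ∀ {u v u' v' : ℕ}, u < 2 ^ n → u' < 2 ^ n → u + 2 ^ n * v = u' + 2 ^ n * v' →
      u = u' ∧ v = v' := by
    intro u v u' v' hu hu' h
    have h1 := congrArg (· % 2 ^ n) h
    have h2 := congrArg (· / 2 ^ n) h
    simp only [Nat.add_mul_mod_self_left, Nat.mod_eq_of_lt hu, Nat.mod_eq_of_lt hu'] at h1
    simp only [Nat.add_mul_div_left _ _ (show 0 < 2 ^ n by positivity), Nat.div_eq_of_lt hu,
      Nat.div_eq_of_lt hu', zero_add] at h2
    exact ⟨h1, h2⟩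
  obtain ⟨h1, h2⟩ := key hx hx' h
  exact ⟨h1, key hy hy' h2⟩

/-! ### Functions that escape every adversary -/

/-- The adversary's value for `t` at the place `j`, for the tables coded by `a`, `b`, `t` and the
program numbers `p`, `q`, `r`. The first three base `2 ^ n` digits of `j` are the values of the
strings `x`, `y`, `z`. -/
def guess (n m a b t j p q r : ℕ) : ℕ :=
  digit (2 ^ n) t (pairIndex m
    (digit (2 ^ m) a (pairIndex n (digit (2 ^ n) j 0) (digit (2 ^ n) j 1) p))
    (digit (2 ^ m) b (pairIndex n (digit (2 ^ n) j 1) (digit (2 ^ n) j 2) q)) r)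

/-- The function coded by `f` takes, at some place, a value that the adversary with the tables
`a`, `b`, `t` misses for all programs of length less than `c`. A place `j` consists of a triple of
strings of length `n` (the three lowest base `2 ^ n` digits of `j`) and of a position less than `n`
in its list of candidates (the quotient `j / 2 ^ (3 * n)`). -/
def Escapes (n m c f a b t : ℕ) : Prop :=
  ∃ j < n * 2 ^ (3 * n), ∀ p < 2 ^ c, ∀ q < 2 ^ c, ∀ r < 2 ^ c,
    digit (2 ^ n) f j ≠ guess n m a b t j p q r

/-- The function coded by `f` escapes every adversary. -/
def IsRich (n m c f : ℕ) : Prop :=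
  ∀ a < (2 ^ m) ^ 2 ^ (2 * n + c), ∀ b < (2 ^ m) ^ 2 ^ (2 * n + c),
    ∀ t < (2 ^ n) ^ 2 ^ (2 * m + c), Escapes n m c f a b t

theorem card_not_escapes_le (n m c a b t : ℕ) :
    Set.ncard {f | f < (2 ^ n) ^ (n * 2 ^ (3 * n)) ∧ ¬ Escapes n m c f a b t} ≤
      2 ^ (3 * c * (n * 2 ^ (3 * n))) := by
  rw [pow_mul 2 (3 * c)]
  refine le_trans (Set.ncard_le_ncard ?_ ?_)
    (card_covered_le (2 ^ n) (n * 2 ^ (3 * n)) (2 ^ (3 * c)) fun s j =>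
      guess n m a b t j (digit (2 ^ c) s 0) (digit (2 ^ c) s 1) (digit (2 ^ c) s 2))
  -- A triple of program numbers is coded by a single number `s` with three digits in base `2 ^ c`.
  · rintro f ⟨hf, h⟩
    refine ⟨hf, fun j hj => ?_⟩
    simp only [Escapes, not_exists, not_and, not_forall, not_not] at h
    obtain ⟨p, hp, q, hq, r, hr, e⟩ := h j hj
    obtain ⟨s, hs, hd⟩ := exists_digit_eq (b := 2 ^ c) 3
      (fun i => if i = 0 then p else if i = 1 then q else r) (fun i => by
        split_ifs <;> assumption)
    refine ⟨s, by rwa [mul_comm 3 c, pow_mul], ?_⟩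
    rw [e, hd 0 (by norm_num), hd 1 (by norm_num), hd 2 (by norm_num)]
    simp
  · exact (Set.finite_lt_nat _).subset fun f hf => hf.1

theorem exists_isRich {n m c : ℕ} (h₁ : 3 * c + 3 < n) (h₂ : 2 * m + c + 3 < 3 * n) :
    ∃ f, IsRich n m c f := by
  by_contra! hno
  set D := n * 2 ^ (3 * n) with hD
  set α := (2 ^ m) ^ 2 ^ (2 * n + c) with hα
  set τ := (2 ^ n) ^ 2 ^ (2 * m + c) with hτ
  let bad : ℕ × ℕ × ℕ → Set ℕ := fun w =>
    {f | f < (2 ^ n) ^ D ∧ ¬ Escapes n m c f w.1 w.2.1 w.2.2}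
  let W : Finset (ℕ × ℕ × ℕ) := Finset.range α ×ˢ Finset.range α ×ˢ Finset.range τ
  have hcov : (Finset.range ((2 ^ n) ^ D) : Set ℕ) ⊆ ⋃ w ∈ W, bad w := by
    intro f hf
    have := hno f
    simp only [IsRich, not_forall] at this
    obtain ⟨a, ha, b, hb, t, ht, h⟩ := this
    simp only [Set.mem_iUnion]
    exact ⟨(a, b, t), by simp [W, α, τ, ha, hb, ht], by simpa using hf, h⟩
  have hfin : ∀ w, (bad w).Finite := fun w =>
    (Set.finite_lt_nat ((2 ^ n) ^ D)).subset fun f hf => hf.1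
  have h1 : (2 ^ n) ^ D ≤ W.card * 2 ^ (3 * c * D) := by
    calc (2 ^ n) ^ D = Set.ncard (Finset.range ((2 ^ n) ^ D) : Set ℕ) := by simp
      _ ≤ Set.ncard (⋃ w ∈ W, bad w) :=
        Set.ncard_le_ncard hcov (W.finite_toSet.biUnion fun w _ => hfin w)
      _ ≤ ∑ w ∈ W, (bad w).ncard := Finset.set_ncard_biUnion_le W bad
      _ ≤ ∑ w ∈ W, 2 ^ (3 * c * D) :=
        Finset.sum_le_sum fun w _ => card_not_escapes_le n m c w.1 w.2.1 w.2.2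
      _ = _ := by simp
  have h2 : W.card * 2 ^ (3 * c * D) =
      2 ^ (2 * (m * 2 ^ (2 * n + c)) + n * 2 ^ (2 * m + c) + 3 * c * D) := by
    simp only [W, Finset.card_product, Finset.card_range, α, τ, ← pow_mul, ← pow_add]
    congr 1; ring
  rw [h2, ← pow_mul] at h1
  have h3 := (Nat.pow_le_pow_iff_right (by norm_num : 1 < 2)).1 h1
  -- The tables take at most `2 * D / 4 + D / 4 < D` bits in total, and `3 * c + 1 ≤ n`.
  have h4 : 4 * 2 ^ (2 * m + c) ≤ 2 ^ (3 * n) := by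
    rw [show (4 : ℕ) = 2 ^ 2 by norm_num, ← pow_add]
    exact Nat.pow_le_pow_right two_pos (by omega)
  have h5 : 8 * 2 ^ (2 * n + c) ≤ 2 ^ (3 * n) := by
    rw [show (8 : ℕ) = 2 ^ 3 by norm_num, ← pow_add]
    exact Nat.pow_le_pow_right two_pos (by omega)
  have h6 : (3 * c + 1) * D ≤ n * D := Nat.mul_le_mul_right _ (by omega)
  have h7 : 4 * (n * 2 ^ (2 * m + c)) ≤ D := by rw [hD]; nlinarith
  have h8 : m * (8 * 2 ^ (2 * n + c)) ≤ 2 * D := by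
    rw [hD, ← mul_assoc 2]; exact Nat.mul_le_mul (by omega) h5
  have h9 : 0 < D := by rw [hD]; have : 0 < n := by omega
                        positivity
  nlinarith

/-! ### Computability -/

theorem primrec_pow : Primrec₂ ((· ^ ·) : ℕ → ℕ → ℕ) := by
  refine (Primrec.nat_rec' (f := fun p : ℕ × ℕ => p.2) (g := fun _ => 1)
    (h := fun p q => q.2 * p.1) Primrec.snd (Primrec.const 1)
    (Primrec.nat_mul.comp (Primrec.snd.comp Primrec.snd)
      (Primrec.fst.comp Primrec.fst)).to₂).of_eq ?_
  rintro ⟨b, e⟩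
  induction e with
  | zero => simp
  | succ e ih => simp only at ih ⊢; rw [ih, pow_succ]

section Primrec
variable {α : Type*} [Primcodable α]

theorem primrec_two_pow {f : α → ℕ} (hf : Primrec f) : Primrec fun x => 2 ^ f x :=
  primrec_pow.comp (.const 2) hf

theorem primrec_digit {b a j : α → ℕ} (hb : Primrec b) (ha : Primrec a) (hj : Primrec j) :
    Primrec fun x => digit (b x) (a x) (j x) :=
  Primrec.nat_mod.comp (Primrec.nat_div.comp ha (primrec_pow.comp hb hj)) hb

theorem primrec_pairIndex {n x y p : α → ℕ} (hn : Primrec n) (hx : Primrec x) (hy : Primrec y)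
    (hp : Primrec p) : Primrec fun w => pairIndex (n w) (x w) (y w) (p w) :=
  have h2 := primrec_two_pow hn
  Primrec.nat_add.comp hx (Primrec.nat_mul.comp h2
    (Primrec.nat_add.comp hy (Primrec.nat_mul.comp h2 hp)))

theorem primrecPred_forall_lt {R : ℕ → α → Prop} {g : α → ℕ} (hg : Primrec g)
    (hR : PrimrecPred fun w : ℕ × α => R w.1 w.2) : PrimrecPred fun a => ∀ x < g a, R x a :=
  ((PrimrecRel.forall_mem_list (R := R) hR).comp (Primrec.list_range.comp hg) Primrec.id).of_eq
    (by simp)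

theorem primrecPred_exists_lt {R : ℕ → α → Prop} {g : α → ℕ} (hg : Primrec g)
    (hR : PrimrecPred fun w : ℕ × α => R w.1 w.2) : PrimrecPred fun a => ∃ x < g a, R x a :=
  ((PrimrecRel.exists_mem_list (R := R) hR).comp (Primrec.list_range.comp hg) Primrec.id).of_eq
    (by simp)

theorem primrec_guess {n m a b t j p q r : α → ℕ} (hn : Primrec n) (hm : Primrec m)
    (ha : Primrec a) (hb : Primrec b) (ht : Primrec t) (hj : Primrec j) (hp : Primrec p)
    (hq : Primrec q) (hr : Primrec r) :
    Primrec fun x => guess (n x) (m x) (a x) (b x) (t x) (j x) (p x) (q x) (r x) := by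
  have hN := primrec_two_pow hn
  have hM := primrec_two_pow hm
  have block : ∀ i : ℕ, Primrec fun x => digit (2 ^ n x) (j x) i := fun i =>
    primrec_digit hN hj (.const i)
  exact primrec_digit hN ht (primrec_pairIndex hm
    (primrec_digit hM ha (primrec_pairIndex hn (block 0) (block 1) hp))
    (primrec_digit hM hb (primrec_pairIndex hn (block 1) (block 2) hq)) hr)

theorem primrecPred_isRich {n m c f : α → ℕ} (hn : Primrec n) (hm : Primrec m) (hc : Primrec c)
    (hf : Primrec f) : PrimrecPred fun x => IsRich (n x) (m x) (c x) (f x) := by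
  have bound : ∀ {n m c : α → ℕ}, Primrec n → Primrec m → Primrec c →
      Primrec fun x => (2 ^ m x) ^ 2 ^ (2 * n x + c x) := fun hn hm hc =>
    primrec_pow.comp (primrec_two_pow hm) (primrec_two_pow
      (Primrec.nat_add.comp (Primrec.nat_mul.comp (.const 2) hn) hc))
  refine primrecPred_forall_lt (bound hn hm hc) ?_
  refine primrecPred_forall_lt ((bound hn hm hc).comp .snd) ?_
  refine primrecPred_forall_lt ((bound hm hn hc).comp (Primrec.snd.comp .snd)) ?_
  refine primrecPred_exists_lt (Primrec.comp (Primrec.nat_mul.comp hn (primrec_two_pow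
    (Primrec.nat_mul.comp (.const 3) hn))) (Primrec.snd.comp (Primrec.snd.comp .snd))) ?_
  refine primrecPred_forall_lt ((primrec_two_pow hc).comp
    (Primrec.snd.comp (Primrec.snd.comp (Primrec.snd.comp .snd)))) ?_
  refine primrecPred_forall_lt ((primrec_two_pow hc).comp
    (Primrec.snd.comp (Primrec.snd.comp (Primrec.snd.comp (Primrec.snd.comp .snd))))) ?_
  refine primrecPred_forall_lt ((primrec_two_pow hc).comp (Primrec.snd.comp
    (Primrec.snd.comp (Primrec.snd.comp (Primrec.snd.comp (Primrec.snd.comp .snd)))))) ?_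
  have d1 : Primrec fun w : ℕ × ℕ × ℕ × ℕ × ℕ × ℕ × ℕ × α => w.2 := .snd
  have d2 := Primrec.snd.comp d1
  have d3 := Primrec.snd.comp d2
  have d4 := Primrec.snd.comp d3
  have d5 := Primrec.snd.comp d4
  have d6 := Primrec.snd.comp d5
  have d7 := Primrec.snd.comp d6
  have hj := Primrec.fst.comp d3
  exact (Primrec.eq.comp
    (primrec_digit (primrec_two_pow (hn.comp d7)) (hf.comp d7) hj)
    (primrec_guess (hn.comp d7) (hm.comp d7) (Primrec.fst.comp d6) (Primrec.fst.comp d5)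
      (Primrec.fst.comp d4) hj (Primrec.fst.comp d2) (Primrec.fst.comp d1) .fst)).not

theorem primrec_val : Primrec val :=
  Primrec.list_foldr .id (.const 0) (Primrec.nat_add.comp
    (Primrec.cond (Primrec.fst.comp .snd) (.const 1) (.const 0))
    (Primrec.nat_mul.comp (.const 2) (Primrec.snd.comp .snd))).to₂ |>.of_eq fun s => by
      rw [val]; congr 1

theorem primrec_bits {n v : α → ℕ} (hn : Primrec n) (hv : Primrec v) :
    Primrec fun x => bits (n x) (v x) :=
  Primrec.list_map (Primrec.list_range.comp hn) (Primrec.eq.decide.comp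
    (Primrec.nat_mod.comp (Primrec.nat_div.comp (hv.comp .fst) (primrec_two_pow .snd)) (.const 2))
    (.const 1)).to₂

end Primrec

open Classical in
/-- The decompressor that reads numbers `m`, `c`, `i` off its program, searches for the least code
of a function that escapes every adversary, and outputs the `i`-th candidate of that function on the
condition. The condition is meant to be a triple of strings of equal length, so `n` is a third of
the total length, and the concatenation of the strings gives the place up to the position `i`. -/
noncomputable def richDecompressor : Decompressor := fun p s =>
  (Nat.rfind fun f => Part.some (decide (IsRich (s.flatten.length / 3) (val p).unpair.1
    (val p).unpair.2.unpair.1 f))).map fun f =>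
      bits (s.flatten.length / 3) (digit (2 ^ (s.flatten.length / 3)) f
        (val s.flatten + 2 ^ (3 * (s.flatten.length / 3)) * (val p).unpair.2.unpair.2))

theorem partrec_richDecompressor : Partrec₂ richDecompressor := by
  classical
  have hs : Primrec fun w : (Str × List Str) × ℕ => w.1.2.flatten :=
    Primrec.list_flatten.comp (Primrec.snd.comp .fst)
  have hn : Primrec fun w : (Str × List Str) × ℕ => w.1.2.flatten.length / 3 :=
    Primrec.nat_div.comp (Primrec.list_length.comp hs) (.const 3)
  have hP : Primrec fun w : (Str × List Str) × ℕ => (val w.1.1).unpair :=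
    Primrec.unpair.comp (primrec_val.comp (Primrec.fst.comp .fst))
  have hci := Primrec.unpair.comp (Primrec.snd.comp hP)
  have hrich := (primrecPred_isRich hn (Primrec.fst.comp hP) (Primrec.fst.comp hci) .snd).decide
  have hout := primrec_bits hn (primrec_digit (primrec_two_pow hn) .snd (Primrec.nat_add.comp
      (primrec_val.comp hs) (Primrec.nat_mul.comp
        (primrec_two_pow (Primrec.nat_mul.comp (.const 3) hn)) (Primrec.snd.comp hci))))
  exact Partrec.map (Partrec.rfind hrich.to_comp.partrec) hout.to_comp

/-! ### Complexity bounds -/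

/-- The outputs of length `m` of a decompressor, on programs of length less than `c` and pairs of
strings of length `n`, are entries of a table. -/
theorem exists_code (U : Decompressor) (n m c : ℕ) :
    ∃ a < (2 ^ m) ^ 2 ^ (2 * n + c), ∀ p x y u : Str, p.length < c → x.length = n →
      y.length = n → u.length = m → u ∈ U p [x, y] →
        digit (2 ^ m) a (pairIndex n (val x) (val y) (progIndex p)) = val u := by
  classical
  let R : ℕ → Str → Prop := fun k u => ∃ p x y : Str, x.length = n ∧ y.length = n ∧
    u.length = m ∧ u ∈ U p [x, y] ∧ k = pairIndex n (val x) (val y) (progIndex p)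
  obtain ⟨a, ha, h⟩ := exists_digit_eq (b := 2 ^ m) (2 ^ (2 * n + c))
    (fun k => if h : ∃ u, R k u then val h.choose else 0) (fun k => by
      split_ifs with h
      · obtain ⟨_, _, _, _, _, hl, _⟩ := h.choose_spec
        exact hl ▸ val_lt _
      · positivity)
  refine ⟨a, ha, fun p x y u hp hx hy hu hU => ?_⟩
  rw [h _ (pairIndex_lt (hx ▸ val_lt x) (hy ▸ val_lt y) (progIndex_lt hp))]
  have hR : ∃ v, R (pairIndex n (val x) (val y) (progIndex p)) v :=
    ⟨u, p, x, y, hx, hy, hu, hU, rfl⟩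
  rw [dif_pos hR]
  obtain ⟨p', x', y', hx', hy', _, hU', e⟩ := hR.choose_spec
  obtain ⟨e1, e2, e3⟩ := pairIndex_inj (hx ▸ val_lt x) (hy ▸ val_lt y) (hx' ▸ val_lt x')
    (hy' ▸ val_lt y') e
  obtain rfl := val_injOn (hx.trans hx'.symm) e1
  obtain rfl := val_injOn (hy.trans hy'.symm) e2
  obtain rfl := progIndex_injective e3
  rw [Part.mem_unique hU' hU]

theorem exists_program_of_complexity_lt {D : Decompressor} {t : Str} {s : List Str} {c : ℕ}
    (h : complexity D t s < c) : ∃ p : Str, p.length < c ∧ t ∈ D p s := by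
  obtain ⟨⟨p, hp⟩, hlt⟩ := iInf_lt_iff.1 h
  exact ⟨p, by exact_mod_cast hlt, hp⟩

theorem complexity_le_length {D : Decompressor} {t p : Str} {s : List Str} (h : t ∈ D p s) :
    complexity D t s ≤ p.length :=
  iInf_le (fun p : {p : Str // t ∈ D p s} => ((p : Str).length : ℕ∞)) ⟨p, h⟩

theorem pair_pair_lt {n m c i : ℕ} (hm : m < n ^ 2) (hc : c < n) (hi : i < n) :
    Nat.pair m (Nat.pair c i) < n ^ 4 := by
  have h1 : Nat.pair c i < n ^ 2 := (Nat.pair_lt_max_add_one_sq c i).trans_le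
    (Nat.pow_le_pow_left (max_lt hc hi) 2)
  calc _ < (max m (Nat.pair c i) + 1) ^ 2 := Nat.pair_lt_max_add_one_sq _ _
    _ ≤ (n ^ 2) ^ 2 := Nat.pow_le_pow_left (max_lt hm h1) 2
    _ = n ^ 4 := by ring

/-- Some function that escapes every adversary has only values of logarithmic complexity relative to
their arguments. -/
theorem exists_isRich_complexity_le {n m c : ℕ} (h₁ : 3 * c + 3 < n)
    (h₂ : 2 * m + c + 3 < 3 * n) : ∃ f, IsRich n m c f ∧ ∀ j < n * 2 ^ (3 * n),
      complexity richDecompressor (bits n (digit (2 ^ n) f j))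
        [bits n (digit (2 ^ n) j 0), bits n (digit (2 ^ n) j 1), bits n (digit (2 ^ n) j 2)] ≤
          (8 * Nat.log 2 n : ℕ) := by
  classical
  obtain ⟨f₀, hf₀⟩ := exists_isRich h₁ h₂
  obtain ⟨f, hf, -⟩ := Nat.rfind_min' (p := fun f => decide (IsRich n m c f)) (m := f₀)
    (by simpa using hf₀)
  refine ⟨f, by simpa using Nat.rfind_spec hf, fun j hj => ?_⟩
  set i := j / 2 ^ (3 * n) with hi
  have hin : i < n := Nat.div_lt_of_lt_mul (by rwa [mul_comm])
  -- `n ^ 4 ≤ 2 ^ (4 * (log₂ n + 1))` bounds the length of the program coding `m`, `c`, `i`.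
  have hP : Nat.pair m (Nat.pair c i) < 2 ^ (4 * (Nat.log 2 n + 1)) := by
    refine (pair_pair_lt (n := n) (by nlinarith) (by omega) hin).trans_le ?_
    rw [mul_comm 4, pow_mul]
    exact Nat.pow_le_pow_left (Nat.lt_pow_succ_log_self (by norm_num) n).le 4
  have hlog : 1 ≤ Nat.log 2 n := Nat.log_pos (by norm_num) (by omega)
  set s : List Str :=
    [bits n (digit (2 ^ n) j 0), bits n (digit (2 ^ n) j 1), bits n (digit (2 ^ n) j 2)] with hs
  have hlen : s.flatten.length / 3 = n := by simp [hs]; omega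
  have hval : val s.flatten + 2 ^ (3 * n) * i = j := by
    have e : val s.flatten = j % (2 ^ n * (2 ^ n * 2 ^ n)) := by
      simp only [hs, List.flatten_cons, List.flatten_nil, List.append_nil, val_append,
        length_bits, val_bits, digit, Nat.mod_mod, Nat.mod_mul, pow_zero, Nat.div_one, pow_one,
        Nat.div_div_eq_div_mul, pow_two]
    rw [e, hi, show 3 * n = n + (n + n) by ring, pow_add, pow_add]
    exact Nat.mod_add_div _ _
  refine (complexity_le_length (p := bits (4 * (Nat.log 2 n + 1)) (Nat.pair m (Nat.pair c i)))
    ?_).trans ?_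
  · simp only [richDecompressor, hlen, val_bits, Nat.mod_eq_of_lt hP, Nat.unpair_pair, hval]
    exact Part.mem_map _ hf
  · rw [length_bits]
    exact_mod_cast (by omega : 4 * (Nat.log 2 n + 1) ≤ 8 * Nat.log 2 n)

end Kolmogorov

open Kolmogorov in
theorem theorem6 (U : Kolmogorov.Decompressor) (hU : Kolmogorov.IsOptimal U) :
    ∃ d C : ℕ, ∀ n m c : ℕ, 3 * c + d < n → 2 * m + c + d < 3 * n →
      ∃ x y z t : Kolmogorov.Str,
        x.length = n ∧ y.length = n ∧ z.length = n ∧ t.length = n ∧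
        Kolmogorov.complexity U t [x, y, z] ≤ ((C * Nat.log 2 n : ℕ) : ℕ∞) ∧
        ¬ ∃ a b : Kolmogorov.Str, a.length = m ∧ b.length = m ∧
          Kolmogorov.complexity U a [x, y] < (c : ℕ∞) ∧
          Kolmogorov.complexity U b [y, z] < (c : ℕ∞) ∧
          Kolmogorov.complexity U t [a, b] < (c : ℕ∞) := by
  obtain ⟨k, hk⟩ := hU.le_add _ partrec_richDecompressor
  refine ⟨3, 8 + k, fun n m c h₁ h₂ => ?_⟩
  obtain ⟨f, hf, hshort⟩ := exists_isRich_complexity_le h₁ h₂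
  obtain ⟨α, hα, hα'⟩ := exists_code U n m c
  obtain ⟨τ, hτ, hτ'⟩ := exists_code U m n c
  obtain ⟨j, hj, hne⟩ := hf α hα α hα τ hτ
  have hval : ∀ v i, val (bits n (digit (2 ^ n) v i)) = digit (2 ^ n) v i := fun v i => by
    rw [val_bits, digit, Nat.mod_mod]
  refine ⟨bits n (digit (2 ^ n) j 0), bits n (digit (2 ^ n) j 1), bits n (digit (2 ^ n) j 2),
    bits n (digit (2 ^ n) f j), length_bits _ _, length_bits _ _, length_bits _ _,
    length_bits _ _, ?_, ?_⟩
  · have hlog : 1 ≤ Nat.log 2 n := Nat.log_pos (by norm_num) (by omega)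
    refine (hk _ _).trans ((add_le_add_left (hshort j hj) _).trans ?_)
    exact_mod_cast (by nlinarith : 8 * Nat.log 2 n + k ≤ (8 + k) * Nat.log 2 n)
  · rintro ⟨a, b, hla, hlb, ha, hb, ht⟩
    obtain ⟨p, hp, hpa⟩ := exists_program_of_complexity_lt ha
    obtain ⟨q, hq, hqb⟩ := exists_program_of_complexity_lt hb
    obtain ⟨r, hr, hrt⟩ := exists_program_of_complexity_lt ht
    have ea := hα' p _ _ a hp (length_bits _ _) (length_bits _ _) hla hpa
    have eb := hα' q _ _ b hq (length_bits _ _) (length_bits _ _) hlb hqb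
    have et := hτ' r a b _ hr hla hlb (length_bits _ _) hrt
    rw [hval, hval] at ea eb
    rw [hval] at et
    refine hne _ (progIndex_lt hp) _ (progIndex_lt hq) _ (progIndex_lt hr) ?_
    rw [guess, ea, eb, et]
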